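/- Let $n\ge 1$ and let $X=(X_1,\dots,X_n)\sim\mathcal N(0,C)$ be a centered multivariate Gaussian random vector whose covariance matrix $C$ (possibly singular) has unit diagonal, $C_{ii}=1$ for all $i$. Let $\Phi$ be the cumulative distribution function of the standard Gaussian law, let $$\widehat F_n(t)=\frac1n\sum_{i=1}^n \mathbf 1(\Phi(X_i)\le t),\qquad t\in\mathbb R,$$ and let $\Delta=\sum_{i\ne j}|C_{ij}|$ (sum over ordered pairs). Then $$\mathbf E\sup_{t\in\mathbb R}\bigl|\widehat F_n(t)-\mathbf E\widehat F_n(t)\bigr|\le 16\,\sqrt[3]{\frac{n+\Delta}{n^2}}.$$ -/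

import Mathlib

open MeasureTheory ProbabilityTheory

noncomputable section

/-- The cumulative distribution function `Φ` of the standard Gaussian law `N(0, 1)`. -/
def stdNormalCDF (x : ℝ) : ℝ := cdf (gaussianReal 0 1) x

/-- The empirical distribution function `(1 / n) ∑ i, 1(Φ(x i) ≤ t)` of the transformed coordinates
of a vector `x` of `ℝⁿ`. -/
def empiricalDistribution {n : ℕ} (x : EuclideanSpace ℝ (Fin n)) (t : ℝ) : ℝ :=
  (1 / (n : ℝ)) * ∑ i : Fin n, if stdNormalCDF (x i) ≤ t then (1 : ℝ) else 0

/-- The dependence measure `Δ = ∑_{i ≠ j} |C i j|`, a sum over ordered pairs of distinct indices. -/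
def offDiagAbsSum {n : ℕ} (C : Matrix (Fin n) (Fin n) ℝ) : ℝ :=
  ∑ i : Fin n, ∑ j : Fin n, if i ≠ j then |C i j| else 0

end

theorem abs_covariance_le_two_mul_integral_abs {Ω : Type*} [MeasurableSpace Ω] {P : Measure Ω}
    [IsProbabilityMeasure P] {U W : Ω → ℝ} (hU : MemLp U 2 P) (hW : MemLp W 2 P)
    (hU1 : ∀ ω, |U ω| ≤ 1) : |cov[U, W; P]| ≤ 2 * ∫ ω, |W ω| ∂P := by
  have hWi : Integrable W P := hW.integrable (by norm_num)
  rw [covariance_eq_sub hU hW]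
  have h1 : |∫ ω, (U * W) ω ∂P| ≤ ∫ ω, |W ω| ∂P := by
    refine (abs_integral_le_integral_abs).trans
      (integral_mono_of_nonneg (.of_forall fun _ ↦ abs_nonneg _) hWi.abs (.of_forall fun ω ↦ ?_))
    simp only [Pi.mul_apply, abs_mul]
    exact mul_le_of_le_one_left (abs_nonneg _) (hU1 ω)
  have h2 : |∫ ω, U ω ∂P| ≤ 1 := by
    refine abs_integral_le_integral_abs.trans ?_
    calc ∫ ω, |U ω| ∂P ≤ ∫ _, (1 : ℝ) ∂P :=
          integral_mono_of_nonneg (.of_forall fun _ ↦ abs_nonneg _) (integrable_const _)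
            (.of_forall hU1)
      _ = 1 := by simp
  have h3 : |∫ ω, W ω ∂P| ≤ ∫ ω, |W ω| ∂P := abs_integral_le_integral_abs
  have h4 : |(∫ ω, U ω ∂P) * ∫ ω, W ω ∂P| ≤ ∫ ω, |W ω| ∂P := by
    rw [abs_mul]
    exact (mul_le_of_le_one_left (abs_nonneg _) h2).trans h3
  exact (abs_sub _ _).trans (by linarith)

theorem gaussianReal_le_volume (m : ℝ) {v : NNReal} (hv : 1 / 2 ≤ (v : ℝ)) :
    gaussianReal m v ≤ volume := by
  have hv0 : v ≠ 0 := by rintro rfl; norm_num at hv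
  rw [gaussianReal_of_var_ne_zero m hv0]
  conv_rhs => rw [← withDensity_one (μ := (volume : Measure ℝ))]
  refine withDensity_mono (.of_forall fun x ↦ ?_)
  simp only [gaussianPDF, Pi.one_apply, ENNReal.ofReal_le_one, gaussianPDFReal]
  have h1 : (1 : ℝ) ≤ √(2 * Real.pi * v) := by
    rw [Real.one_le_sqrt]
    nlinarith [Real.pi_gt_three]
  refine mul_le_one₀ (inv_le_one_of_one_le₀ h1) (Real.exp_nonneg _) (Real.exp_le_one_iff.2 ?_)
  exact div_nonpos_of_nonpos_of_nonneg (neg_nonpos.2 (sq_nonneg _)) (by positivity)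

/-- The indicator function of `Iic x`, with real values. -/
noncomputable def indicatorIic (x u : ℝ) : ℝ := if u ≤ x then 1 else 0

theorem measurable_indicatorIic (x : ℝ) : Measurable (indicatorIic x) :=
  Measurable.ite measurableSet_Iic measurable_const measurable_const

theorem abs_indicatorIic_le (x u : ℝ) : |indicatorIic x u| ≤ 1 := by
  unfold indicatorIic; split_ifs <;> simp

theorem lintegral_indicatorIic_shift_le {ν : Measure ℝ} (hν : ν ≤ volume) (x a : ℝ) :
    ∫⁻ z, ‖indicatorIic x (z + a) - indicatorIic x z‖ₑ ∂ν ≤ ‖a‖ₑ := by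
  calc ∫⁻ z, ‖indicatorIic x (z + a) - indicatorIic x z‖ₑ ∂ν
      ≤ ∫⁻ z, (Set.uIoc (x - a) x).indicator 1 z ∂ν := by
        refine lintegral_mono fun z ↦ ?_
        by_cases hz : z ∈ Set.uIoc (x - a) x
        · simp only [Set.indicator_of_mem hz, Pi.one_apply]
          unfold indicatorIic
          split_ifs <;> simp
        · have : indicatorIic x (z + a) - indicatorIic x z = 0 := by
            unfold indicatorIic
            rw [Set.mem_uIoc] at hz
            push Not at hz
            have h : z + a ≤ x ↔ z ≤ x := by
              refine ⟨fun h1 ↦ ?_, fun h2 ↦ ?_⟩ <;> by_contra h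
              · linarith [hz.2 (not_le.1 h)]
              · linarith [hz.1 (by linarith)]
            simp [h]
          simp [this]
    _ = ν (Set.uIoc (x - a) x) := by
        rw [lintegral_indicator_one measurableSet_uIoc]
    _ ≤ volume (Set.uIoc (x - a) x) := hν _
    _ = ‖a‖ₑ := by
        rw [Set.uIoc, Real.volume_Ioc, max_sub_min_eq_abs, Real.enorm_eq_ofReal_abs]
        simp

theorem memLp_indicatorIic_comp {Ω : Type*} [MeasurableSpace Ω] {P : Measure Ω}
    [IsProbabilityMeasure P] {Y : Ω → ℝ} (hY : AEMeasurable Y P) (x : ℝ) :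
    MemLp (fun ω ↦ indicatorIic x (Y ω)) 2 P :=
  MemLp.of_bound ((measurable_indicatorIic x).comp_aemeasurable hY).aestronglyMeasurable 1
    (.of_forall fun ω ↦ abs_indicatorIic_le x (Y ω))

theorem integral_abs_indicatorIic_perturb_le {Ω : Type*} [MeasurableSpace Ω] {P : Measure Ω}
    [IsProbabilityMeasure P] {X Z : Ω → ℝ} {m : ℝ} {v : NNReal} (hv : 1 / 2 ≤ (v : ℝ))
    (hX : HasLaw X (gaussianReal 0 1) P) (hZ : HasLaw Z (gaussianReal m v) P)
    (hXZ : IndepFun X Z P) (x ρ : ℝ) :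
    ∫ ω, |indicatorIic x (Z ω + ρ * X ω) - indicatorIic x (Z ω)| ∂P ≤ |ρ| := by
  have hmeas : Measurable fun p : ℝ × ℝ ↦
      ‖indicatorIic x (p.2 + ρ * p.1) - indicatorIic x p.2‖ₑ := by
    have := measurable_indicatorIic x
    fun_prop
  have hEX : ∫⁻ u, ‖u‖ₑ ∂(gaussianReal 0 1) ≤ 1 := by
    have hi : Integrable (fun u : ℝ ↦ u) (gaussianReal 0 1) :=
      (memLp_id_gaussianReal 1).integrable (by norm_num)
    have hi2 : Integrable (fun u : ℝ ↦ u ^ 2) (gaussianReal 0 1) :=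
      (memLp_id_gaussianReal 2).integrable_sq
    have h2 : ∫ u, u ^ 2 ∂(gaussianReal 0 1) = 1 := by
      have := variance_fun_id_gaussianReal (μ := 0) (v := 1)
      rw [variance_eq_integral (by fun_prop)] at this
      simpa using this
    have : ∫ u, |u| ∂(gaussianReal 0 1) ≤ 1 := by
      calc ∫ u, |u| ∂(gaussianReal 0 1) ≤ ∫ u, (1 + u ^ 2) / 2 ∂(gaussianReal 0 1) := by
            refine integral_mono hi.abs (((integrable_const _).add hi2).div_const _) fun u ↦ ?_
            simp only
            nlinarith [sq_nonneg (|u| - 1), sq_abs u]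
        _ = 1 := by
            rw [integral_div, integral_add (integrable_const _) hi2, h2]; norm_num
    rw [lintegral_congr fun u ↦ Real.enorm_eq_ofReal_abs u,
      ← ofReal_integral_eq_lintegral_ofReal hi.abs (.of_forall fun _ ↦ abs_nonneg _)]
    simpa using ENNReal.ofReal_le_ofReal this
  have key : ∫⁻ ω, ‖indicatorIic x (Z ω + ρ * X ω) - indicatorIic x (Z ω)‖ₑ ∂P
      ≤ ENNReal.ofReal |ρ| := by
    have hlaw : P.map (fun ω ↦ (X ω, Z ω)) = (gaussianReal 0 1).prod (gaussianReal m v) := by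
      rw [(indepFun_iff_map_prod_eq_prod_map_map hX.aemeasurable hZ.aemeasurable).1 hXZ,
        hX.map_eq, hZ.map_eq]
    rw [← lintegral_map' (f := fun p : ℝ × ℝ ↦
        ‖indicatorIic x (p.2 + ρ * p.1) - indicatorIic x p.2‖ₑ) (g := fun ω ↦ (X ω, Z ω))
        hmeas.aemeasurable (hX.aemeasurable.prodMk hZ.aemeasurable), hlaw,
      lintegral_prod _ hmeas.aemeasurable]
    calc _ ≤ ∫⁻ u, ‖ρ‖ₑ * ‖u‖ₑ ∂(gaussianReal 0 1) := by
          refine lintegral_mono fun u ↦ ?_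
          rw [← enorm_mul]
          exact lintegral_indicatorIic_shift_le (gaussianReal_le_volume m hv) x (ρ * u)
      _ = ‖ρ‖ₑ * ∫⁻ u, ‖u‖ₑ ∂(gaussianReal 0 1) := lintegral_const_mul _ (by fun_prop)
      _ ≤ ‖ρ‖ₑ * 1 := by gcongr
      _ = _ := by rw [mul_one, Real.enorm_eq_ofReal_abs]
  have hae : AEMeasurable (fun ω ↦ Z ω + ρ * X ω) P :=
    hZ.aemeasurable.add (hX.aemeasurable.const_mul ρ)
  have hint := ((memLp_indicatorIic_comp hae x).sub
    (memLp_indicatorIic_comp hZ.aemeasurable x)).integrable (by norm_num)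
  simp only [Pi.sub_def] at hint
  rw [integral_eq_lintegral_of_nonneg_ae (.of_forall fun _ ↦ abs_nonneg _)
    hint.abs.aestronglyMeasurable]
  refine ENNReal.toReal_le_of_le_ofReal (abs_nonneg _) ?_
  simpa only [Real.enorm_eq_ofReal_abs] using key

/-- Indicators of the same half-line at two jointly Gaussian standard variables have covariance at
most a constant times the covariance of the variables. -/
theorem abs_covariance_indicatorIic_le {Ω : Type*} [MeasurableSpace Ω] {P : Measure Ω}
    [IsProbabilityMeasure P] {X Y : Ω → ℝ} (hXY : HasGaussianLaw (fun ω ↦ (X ω, Y ω)) P)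
    (hX : HasLaw X (gaussianReal 0 1) P) (hY : HasLaw Y (gaussianReal 0 1) P) (x : ℝ) :
    |cov[fun ω ↦ indicatorIic x (X ω), fun ω ↦ indicatorIic x (Y ω); P]|
      ≤ 4 * |cov[X, Y; P]| := by
  set ρ := cov[X, Y; P] with hρ
  have hmX := memLp_indicatorIic_comp hX.aemeasurable x
  have hmY := memLp_indicatorIic_comp hY.aemeasurable x
  rcases lt_or_ge (1 / 2) |ρ| with h | h
  · refine (abs_covariance_le_two_mul_integral_abs hmX hmY
      fun ω ↦ abs_indicatorIic_le x _).trans ?_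
    have : ∫ ω, |indicatorIic x (Y ω)| ∂P ≤ ∫ _, (1 : ℝ) ∂P :=
      integral_mono_of_nonneg (.of_forall fun _ ↦ abs_nonneg _) (integrable_const _)
            (.of_forall fun ω ↦ abs_indicatorIic_le x _)
    simp only [integral_const, probReal_univ, smul_eq_mul, mul_one] at this
    linarith
  have hX2 : MemLp X 2 P := hXY.fst.memLp_two
  have hY2 : MemLp Y 2 P := hXY.snd.memLp_two
  have hVX : cov[X, X; P] = 1 := by
    rw [covariance_self hX.aemeasurable, hX.variance_eq]; simp
  have hVY : cov[Y, Y; P] = 1 := by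
    rw [covariance_self hY.aemeasurable, hY.variance_eq]; simp
  let Z : Ω → ℝ := Y - ρ • X
  have hZ2 : MemLp Z 2 P := hY2.sub (hX2.const_smul ρ)
  have hXZ : HasGaussianLaw (fun ω ↦ (X ω, Z ω)) P := by
    simpa [Z] using hXY.map_fun ((ContinuousLinearMap.fst ℝ ℝ ℝ).prod
      (ContinuousLinearMap.snd ℝ ℝ ℝ - ρ • ContinuousLinearMap.fst ℝ ℝ ℝ))
  have hcov : cov[X, Z; P] = 0 := by
    rw [covariance_sub_right hX2 hY2 (hX2.const_smul ρ), covariance_smul_right, hVX, ← hρ]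
    ring
  have hVZ : Var[Z; P] = 1 - ρ ^ 2 := by
    rw [← covariance_self hZ2.aestronglyMeasurable.aemeasurable]
    conv_lhs => enter [1]; change Y - ρ • X
    rw [covariance_sub_left hY2 (hX2.const_smul ρ) hZ2, covariance_smul_left, hcov,
      covariance_sub_right hY2 hY2 (hX2.const_smul ρ), covariance_smul_right, hVY,
      covariance_comm Y X, ← hρ]
    ring
  have hind : IndepFun X Z P := hXZ.indepFun_of_covariance_eq_zero hcov
  have hZlaw : HasLaw Z (gaussianReal P[Z] Var[Z; P].toNNReal) P :=
    ⟨hXZ.snd.aemeasurable, hXZ.snd.map_eq_gaussianReal⟩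
  have hv : 1 / 2 ≤ (Var[Z; P].toNNReal : ℝ) := by
    have : ρ ^ 2 ≤ 1 / 2 := by rw [← sq_abs]; nlinarith [abs_nonneg ρ]
    refine le_trans ?_ (Real.le_coe_toNNReal _)
    rw [hVZ]; linarith
  have hmZ := memLp_indicatorIic_comp hZlaw.aemeasurable x
  have hYZ : ∀ ω, Z ω + ρ * X ω = Y ω := fun ω ↦ by simp [Z]
  have hsplit : (fun ω ↦ indicatorIic x (Y ω)) = (fun ω ↦ indicatorIic x (Z ω)) +
      fun ω ↦ indicatorIic x (Z ω + ρ * X ω) - indicatorIic x (Z ω) := by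
    ext ω; simp [hYZ]
  have hmD : MemLp (fun ω ↦ indicatorIic x (Z ω + ρ * X ω) - indicatorIic x (Z ω)) 2 P := by
    simp only [hYZ]; exact hmY.sub hmZ
  have hcov0 : cov[fun ω ↦ indicatorIic x (X ω), fun ω ↦ indicatorIic x (Z ω); P] = 0 :=
    (hind.comp (measurable_indicatorIic x) (measurable_indicatorIic x)).covariance_eq_zero hmX hmZ
  rw [hsplit, covariance_add_right hmX hmZ hmD, hcov0, zero_add]
  refine (abs_covariance_le_two_mul_integral_abs hmX hmD
    fun ω ↦ abs_indicatorIic_le x _).trans ?_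
  linarith [integral_abs_indicatorIic_perturb_le hv hX hZlaw hind x ρ, abs_nonneg ρ]

theorem strictMono_stdNormalCDF : StrictMono stdNormalCDF := by
  intro a b hab
  have hd : Set.Iic b = Set.Iic a ∪ Set.Ioc a b := (Set.Iic_union_Ioc_eq_Iic hab.le).symm
  have hpos : 0 < (gaussianReal 0 1).real (Set.Ioc a b) := by
    refine ENNReal.toReal_pos (fun h ↦ ?_) (measure_ne_top _ _)
    have := gaussianReal_absolutelyContinuous' 0 one_ne_zero h
    exact absurd hab (by simpa using this)
  simp only [stdNormalCDF, cdf_eq_real]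
  rw [hd, measureReal_union (Set.Iic_disjoint_Ioc le_rfl) measurableSet_Ioc]
  linarith

theorem continuous_stdNormalCDF : Continuous stdNormalCDF := by
  have : NullSingletonClass (gaussianReal 0 1) := nullSingletonClass_gaussianReal one_ne_zero
  refine continuous_iff_continuousAt.2 fun x ↦ ?_
  have hm := monotone_cdf (gaussianReal 0 1)
  rw [ContinuousAt, stdNormalCDF]
  refine (hm.continuousAt_iff_leftLim_eq_rightLim (x := x)).2 ?_
  rw [StieltjesFunction.rightLim_eq]
  have h := (cdf (gaussianReal 0 1)).measure_singleton x
  rw [measure_cdf, measure_singleton] at h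
  have := ENNReal.ofReal_eq_zero.1 h.symm
  exact le_antisymm (hm.leftLim_le le_rfl) (by linarith)

theorem stdNormalCDF_pos (x : ℝ) : 0 < stdNormalCDF x :=
  (cdf_nonneg _ (x - 1)).trans_lt (strictMono_stdNormalCDF (by linarith))

theorem stdNormalCDF_lt_one (x : ℝ) : stdNormalCDF x < 1 :=
  (strictMono_stdNormalCDF (by linarith : x < x + 1)).trans_le (cdf_le_one _ _)

theorem exists_stdNormalCDF_eq {t : ℝ} (h0 : 0 < t) (h1 : t < 1) : ∃ x, stdNormalCDF x = t :=
  mem_range_of_exists_le_of_exists_ge continuous_stdNormalCDF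
    ((tendsto_cdf_atBot (gaussianReal 0 1)).eventually_le_const h0).exists
    ((tendsto_cdf_atTop (gaussianReal 0 1)).eventually_const_le h1).exists

theorem setOf_stdNormalCDF_le (t : ℝ) :
    (t ≤ 0 ∧ ∀ u, ¬ stdNormalCDF u ≤ t) ∨ (1 ≤ t ∧ ∀ u, stdNormalCDF u ≤ t) ∨
      0 < t ∧ t < 1 ∧ ∃ x, stdNormalCDF x = t ∧ ∀ u, stdNormalCDF u ≤ t ↔ u ≤ x := by
  rcases le_or_gt t 0 with h0 | h0
  · exact .inl ⟨h0, fun u ↦ not_le.2 (h0.trans_lt (stdNormalCDF_pos u))⟩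
  rcases le_or_gt 1 t with h1 | h1
  · exact .inr (.inl ⟨h1, fun u ↦ (stdNormalCDF_lt_one u).le.trans h1⟩)
  obtain ⟨x, rfl⟩ := exists_stdNormalCDF_eq h0 h1
  exact .inr (.inr ⟨h0, h1, x, rfl, fun u ↦ strictMono_stdNormalCDF.le_iff_le⟩)

/-- The indicator function of the event that the probability integral transform of `u` is at most
`t`. -/
noncomputable def indicatorCDFLe (t u : ℝ) : ℝ := if stdNormalCDF u ≤ t then 1 else 0

theorem measurable_indicatorCDFLe (t : ℝ) : Measurable (indicatorCDFLe t) :=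
  Measurable.ite (measurableSet_le continuous_stdNormalCDF.measurable measurable_const)
    measurable_const measurable_const

theorem indicatorCDFLe_nonneg (t u : ℝ) : 0 ≤ indicatorCDFLe t u := by
  unfold indicatorCDFLe; split_ifs <;> simp

theorem indicatorCDFLe_le_one (t u : ℝ) : indicatorCDFLe t u ≤ 1 := by
  unfold indicatorCDFLe; split_ifs <;> simp

/-- The probability integral transform: `Φ` maps the standard Gaussian law to the uniform law. -/
theorem integral_indicatorCDFLe (t : ℝ) :
    ∫ u, indicatorCDFLe t u ∂(gaussianReal 0 1) = max 0 (min t 1) := by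
  rcases setOf_stdNormalCDF_le t with ⟨ht, h⟩ | ⟨ht, h⟩ | ⟨h0, h1, x, hx, h⟩
  · simp [indicatorCDFLe, h, ht]
  · simp [indicatorCDFLe, h, ht]
  · have : indicatorCDFLe t = (Set.Iic x).indicator 1 := by
      ext u
      simp [indicatorCDFLe, h, Set.indicator_apply]
    rw [this, integral_indicator_one measurableSet_Iic, min_eq_left h1.le, max_eq_right h0.le,
      ← cdf_eq_real, ← hx, stdNormalCDF]

theorem abs_covariance_indicatorCDFLe_le {Ω : Type*} [MeasurableSpace Ω] {P : Measure Ω}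
    [IsProbabilityMeasure P] {X Y : Ω → ℝ} (hXY : HasGaussianLaw (fun ω ↦ (X ω, Y ω)) P)
    (hX : HasLaw X (gaussianReal 0 1) P) (hY : HasLaw Y (gaussianReal 0 1) P) (t : ℝ) :
    |cov[fun ω ↦ indicatorCDFLe t (X ω), fun ω ↦ indicatorCDFLe t (Y ω); P]|
      ≤ 4 * |cov[X, Y; P]| := by
  rcases setOf_stdNormalCDF_le t with ⟨-, h⟩ | ⟨-, h⟩ | ⟨-, -, x, -, h⟩
  · simp [indicatorCDFLe, h]
  · simp [indicatorCDFLe, h]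
  · have : indicatorCDFLe t = indicatorIic x := by
      ext u
      simp [indicatorCDFLe, h, indicatorIic]
    rw [this]
    exact abs_covariance_indicatorIic_le hXY hX hY x

theorem empiricalDistribution_eq {n : ℕ} (x : EuclideanSpace ℝ (Fin n)) (t : ℝ) :
    empiricalDistribution x t = (1 / (n : ℝ)) * ∑ i, indicatorCDFLe t (x i) := rfl

theorem monotone_empiricalDistribution {n : ℕ} (x : EuclideanSpace ℝ (Fin n)) :
    Monotone (empiricalDistribution x) := by
  intro s t hst
  simp only [empiricalDistribution]
  gcongr with i
  split_ifs <;> linarith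

theorem measurable_empiricalDistribution (n : ℕ) (t : ℝ) :
    Measurable fun x : EuclideanSpace ℝ (Fin n) ↦ empiricalDistribution x t := by
  simp only [empiricalDistribution_eq]
  have := measurable_indicatorCDFLe t
  fun_prop

theorem empiricalDistribution_nonneg {n : ℕ} (x : EuclideanSpace ℝ (Fin n)) (t : ℝ) :
    0 ≤ empiricalDistribution x t := by
  rw [empiricalDistribution_eq]
  exact mul_nonneg (by positivity) (Finset.sum_nonneg fun i _ ↦ indicatorCDFLe_nonneg _ _)

theorem empiricalDistribution_le_one {n : ℕ} (x : EuclideanSpace ℝ (Fin n)) (t : ℝ) :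
    empiricalDistribution x t ≤ 1 := by
  rw [empiricalDistribution_eq, one_div_mul_eq_div]
  refine div_le_one_of_le₀ ?_ (by positivity)
  simpa using Finset.sum_le_sum fun i (_ : i ∈ Finset.univ) ↦ indicatorCDFLe_le_one t (x i)

theorem empiricalDistribution_of_nonpos {n : ℕ} (x : EuclideanSpace ℝ (Fin n)) {t : ℝ}
    (ht : t ≤ 0) : empiricalDistribution x t = 0 := by
  simp [empiricalDistribution, fun u ↦ not_le.2 (ht.trans_lt (stdNormalCDF_pos u))]

theorem empiricalDistribution_of_one_le {n : ℕ} (hn : 1 ≤ n) (x : EuclideanSpace ℝ (Fin n))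
    {t : ℝ} (ht : 1 ≤ t) : empiricalDistribution x t = 1 := by
  have : (n : ℝ) ≠ 0 := by positivity
  simp [empiricalDistribution, fun u ↦ (stdNormalCDF_lt_one u).le.trans ht, this]

theorem continuousWithinAt_empiricalDistribution {n : ℕ} (x : EuclideanSpace ℝ (Fin n)) (t : ℝ) :
    ContinuousWithinAt (empiricalDistribution x) (Set.Ici t) t := by
  unfold empiricalDistribution
  refine continuousWithinAt_const.mul
    (tendsto_finsetSum _ fun i _ ↦ ?_)
  change ContinuousWithinAt (fun s ↦ if stdNormalCDF (x i) ≤ s then (1 : ℝ) else 0) _ _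
  rcases le_or_gt (stdNormalCDF (x i)) t with h | h
  · refine (continuousWithinAt_const (b := (1 : ℝ))).congr (fun s hs ↦ ?_) (by simp [h])
    simp [h.trans hs]
  · refine ContinuousAt.continuousWithinAt
      ((continuousAt_const (y := (0 : ℝ))).congr ?_)
    filter_upwards [gt_mem_nhds h] with s hs
    simp [hs]

theorem ciSup_eq_ciSup_rat {f : ℝ → ℝ} (hb : BddAbove (Set.range f))
    (hf : ∀ t, ContinuousWithinAt f (Set.Ici t) t) : ⨆ t, f t = ⨆ q : ℚ, f q := by
  have hbq : BddAbove (Set.range fun q : ℚ ↦ f q) := hb.mono (Set.range_comp_subset_range _ f)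
  refine le_antisymm (ciSup_le fun t ↦ ?_) (ciSup_le fun q ↦ le_ciSup hb (q : ℝ))
  have hlim : Filter.Tendsto f (nhdsWithin t (Set.Ioi t)) (nhds (f t)) :=
    ((hf t).mono Set.Ioi_subset_Ici_self)
  refine le_of_forall_pos_lt_add fun ε hε ↦ ?_
  have h1 := hlim.eventually (lt_mem_nhds (sub_lt_self (f t) hε))
  obtain ⟨u, hu, hsub⟩ := mem_nhdsGT_iff_exists_Ioo_subset.1 h1
  obtain ⟨q, hq1, hq2⟩ := exists_rat_btwn (Set.mem_Ioi.1 hu)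
  have h2 : f t - ε < f q := hsub ⟨hq1, hq2⟩
  linarith [le_ciSup hbq q]

/-- A distribution function supported on `[0, 1]` is uniformly close to the uniform one if it is
close on a grid. -/
theorem abs_sub_clamp_le_of_grid {F : ℝ → ℝ} (hF : Monotone F) (h0 : ∀ t ≤ 0, F t = 0)
    (h1 : ∀ t, 1 ≤ t → F t = 1) {k : ℕ} (hk : 0 < k) {M : ℝ} (hM0 : 0 ≤ M)
    (hM : ∀ j : ℕ, j ≤ k → |F (j / k) - max 0 (min (j / k : ℝ) 1)| ≤ M) (t : ℝ) :
    |F t - max 0 (min t 1)| ≤ 1 / k + M := by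
  have hk' : (0 : ℝ) < k := by exact_mod_cast hk
  have hpos : 0 < 1 / (k : ℝ) := by positivity
  rcases le_or_gt t 0 with ht | ht
  · rw [h0 t ht, max_eq_left (min_le_of_left_le ht)]; simp; positivity
  rcases le_or_gt 1 t with ht1 | ht1
  · rw [h1 t ht1, min_eq_right ht1]; simp; positivity
  have hgrid : ∀ j : ℕ, j ≤ k → |F (j / k) - j / k| ≤ M := fun j hj ↦ by
    have := hM j hj
    rwa [min_eq_left (div_le_one_of_le₀ (by exact_mod_cast hj) hk'.le),
      max_eq_right (by positivity)] at this
  rw [min_eq_left ht1.le, max_eq_right ht.le]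
  set j := ⌊(k : ℝ) * t⌋₊ with hj
  have hj1 : (j : ℝ) ≤ k * t := Nat.floor_le (by positivity)
  have hj2 : k * t < j + 1 := Nat.lt_floor_add_one _
  have hjk : j < k := by
    have : (j : ℝ) < k := by nlinarith
    exact_mod_cast this
  have ha : (j : ℝ) / k ≤ t := by rw [div_le_iff₀ hk']; linarith
  have hb : t ≤ ((j + 1 : ℕ) : ℝ) / k := by rw [le_div_iff₀ hk']; push_cast; linarith
  have e : ((j + 1 : ℕ) : ℝ) / k = j / k + 1 / k := by push_cast; ring
  have g1 := abs_le.1 (hgrid j hjk.le)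
  have g2 := abs_le.1 (hgrid (j + 1) hjk)
  have m1 := hF ha
  have m2 := hF hb
  rw [abs_le]
  constructor <;> linarith [g1.1, g2.2]

section MultivariateGaussian

variable {n : ℕ} {C : Matrix (Fin n) (Fin n) ℝ}

theorem hasLaw_eval_multivariateGaussian (hC : C.PosSemidef) (hdiag : ∀ i, C i i = 1) (i : Fin n) :
    HasLaw (fun x : EuclideanSpace ℝ (Fin n) ↦ x i) (gaussianReal 0 1)
      (multivariateGaussian 0 C) := by
  have := (measurePreserving_eval_multivariateGaussian (μ := 0) hC (i := i)).hasLaw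
  simpa [hdiag] using this

theorem memLp_indicatorCDFLe_eval (t : ℝ) (i : Fin n) :
    MemLp (fun x : EuclideanSpace ℝ (Fin n) ↦ indicatorCDFLe t (x i)) 2
      (multivariateGaussian 0 C) := by
  have := measurable_indicatorCDFLe t
  refine MemLp.of_bound (Measurable.aestronglyMeasurable (by fun_prop)) 1 (.of_forall fun x ↦ ?_)
  rw [Real.norm_eq_abs, abs_of_nonneg (indicatorCDFLe_nonneg _ _)]
  exact indicatorCDFLe_le_one _ _

theorem integral_empiricalDistribution (hn : 1 ≤ n) (hC : C.PosSemidef) (hdiag : ∀ i, C i i = 1)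
    (t : ℝ) :
    ∫ x, empiricalDistribution x t ∂(multivariateGaussian 0 C) = max 0 (min t 1) := by
  have hn0 : (n : ℝ) ≠ 0 := by positivity
  simp only [empiricalDistribution_eq]
  rw [integral_const_mul, integral_finsetSum _ fun i _ ↦
    (memLp_indicatorCDFLe_eval t i).integrable (by norm_num)]
  have (i : Fin n) : ∫ x, indicatorCDFLe t (x i) ∂(multivariateGaussian 0 C)
      = max 0 (min t 1) := by
    rw [← integral_indicatorCDFLe]
    exact (hasLaw_eval_multivariateGaussian hC hdiag i).integral_comp
      (measurable_indicatorCDFLe t).aestronglyMeasurable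
  simp [this, hn0]

theorem sum_abs_eq_add_offDiagAbsSum (hdiag : ∀ i, C i i = 1) :
    ∑ i, ∑ j, |C i j| = n + offDiagAbsSum C := by
  have h (i j : Fin n) : |C i j| = (if i = j then 1 else 0) + if i ≠ j then |C i j| else 0 := by
    by_cases hij : i = j
    · subst hij; simp [hdiag]
    · simp [hij]
  calc ∑ i, ∑ j, |C i j|
      = ∑ i : Fin n, ∑ j, ((if i = j then (1 : ℝ) else 0) + if i ≠ j then |C i j| else 0) :=
        Finset.sum_congr rfl fun i _ ↦ Finset.sum_congr rfl fun j _ ↦ h i j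
    _ = n + offDiagAbsSum C := by
        simp only [Finset.sum_add_distrib, offDiagAbsSum]
        simp

theorem integral_sq_empiricalDistribution_sub_le (hn : 1 ≤ n) (hC : C.PosSemidef)
    (hdiag : ∀ i, C i i = 1) (t : ℝ) :
    ∫ x, (empiricalDistribution x t - max 0 (min t 1)) ^ 2 ∂(multivariateGaussian 0 C)
      ≤ 4 * ((n + offDiagAbsSum C) / (n : ℝ) ^ 2) := by
  set μ := multivariateGaussian 0 C with hμ
  have hcov (i j : Fin n) : cov[fun x : EuclideanSpace ℝ (Fin n) ↦ indicatorCDFLe t (x i),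
      fun x ↦ indicatorCDFLe t (x j); μ] ≤ 4 * |C i j| := by
    have hG : HasGaussianLaw (fun x : EuclideanSpace ℝ (Fin n) ↦ (x i, x j)) μ :=
      IsGaussian.hasGaussianLaw_id.map_fun
        ((EuclideanSpace.proj (𝕜 := ℝ) i).prod (EuclideanSpace.proj j))
    have := abs_covariance_indicatorCDFLe_le hG (hasLaw_eval_multivariateGaussian hC hdiag i)
      (hasLaw_eval_multivariateGaussian hC hdiag j) t
    rw [covariance_eval_multivariateGaussian hC] at this
    exact (le_abs_self _).trans this
  have hvar : ∫ x, (empiricalDistribution x t - max 0 (min t 1)) ^ 2 ∂μ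
      = Var[fun x ↦ empiricalDistribution x t; μ] := by
    rw [variance_eq_integral (measurable_empiricalDistribution n t).aemeasurable,
      integral_empiricalDistribution hn hC hdiag]
  rw [hvar]
  simp only [empiricalDistribution_eq]
  rw [variance_const_mul, variance_fun_sum fun i ↦ memLp_indicatorCDFLe_eval t i,
    ← sum_abs_eq_add_offDiagAbsSum hdiag]
  calc _ ≤ (1 / (n : ℝ)) ^ 2 * ∑ i, ∑ j, 4 * |C i j| := by
        gcongr with i _ j _
        exact hcov i j
    _ = _ := by
        simp_rw [← Finset.mul_sum]
        ring

end MultivariateGaussian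

/-- The Kolmogorov distance between the empirical distribution of `(Φ(x i))` and the uniform
distribution on `[0, 1]`. -/
noncomputable def kolmogorovDeviation {n : ℕ} (x : EuclideanSpace ℝ (Fin n)) : ℝ :=
  ⨆ t : ℝ, |empiricalDistribution x t - max 0 (min t 1)|

section KolmogorovDeviation

variable {n : ℕ} (x : EuclideanSpace ℝ (Fin n))

theorem abs_empiricalDistribution_sub_le_one (t : ℝ) :
    |empiricalDistribution x t - max 0 (min t 1)| ≤ 1 := by
  have h1 := empiricalDistribution_nonneg x t
  have h2 := empiricalDistribution_le_one x t
  have h3 : (0 : ℝ) ≤ max 0 (min t 1) := le_max_left _ _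
  have h4 : max 0 (min t 1) ≤ 1 := max_le zero_le_one (min_le_right _ _)
  exact abs_le.2 ⟨by linarith, by linarith⟩

theorem bddAbove_abs_empiricalDistribution_sub :
    BddAbove (Set.range fun t : ℝ ↦ |empiricalDistribution x t - max 0 (min t 1)|) :=
  ⟨1, by rintro _ ⟨t, rfl⟩; exact abs_empiricalDistribution_sub_le_one x t⟩

theorem kolmogorovDeviation_nonneg : 0 ≤ kolmogorovDeviation x :=
  Real.iSup_nonneg fun _ ↦ abs_nonneg _

theorem kolmogorovDeviation_le_one : kolmogorovDeviation x ≤ 1 :=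
  ciSup_le fun t ↦ abs_empiricalDistribution_sub_le_one x t

theorem measurable_kolmogorovDeviation :
    Measurable (kolmogorovDeviation : EuclideanSpace ℝ (Fin n) → ℝ) := by
  have h (x : EuclideanSpace ℝ (Fin n)) : kolmogorovDeviation x =
      ⨆ q : ℚ, |empiricalDistribution x q - max 0 (min (q : ℝ) 1)| := by
    refine ciSup_eq_ciSup_rat (bddAbove_abs_empiricalDistribution_sub x) fun t ↦ ?_
    have h1 := continuousWithinAt_empiricalDistribution x t
    have h2 : Continuous fun t : ℝ ↦ max 0 (min t 1) := by fun_prop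
    exact (h1.sub h2.continuousWithinAt).abs
  rw [show (kolmogorovDeviation : EuclideanSpace ℝ (Fin n) → ℝ) = _ from funext h]
  refine Measurable.iSup fun q ↦ ?_
  have := measurable_empiricalDistribution n q
  fun_prop

theorem integrable_kolmogorovDeviation (μ : Measure (EuclideanSpace ℝ (Fin n)))
    [IsFiniteMeasure μ] : Integrable kolmogorovDeviation μ :=
  Integrable.of_bound measurable_kolmogorovDeviation.aestronglyMeasurable 1
    (.of_forall fun x ↦ by
      rw [Real.norm_eq_abs, abs_of_nonneg (kolmogorovDeviation_nonneg x)]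
      exact kolmogorovDeviation_le_one x)

theorem kolmogorovDeviation_le_grid (hn : 1 ≤ n) {k : ℕ} (hk : 0 < k) {s : ℝ} (hs : 0 < s) :
    kolmogorovDeviation x ≤ 1 / k + (s / 2 + (∑ j ∈ Finset.range (k + 1),
      (empiricalDistribution x (j / k) - max 0 (min (j / k : ℝ) 1)) ^ 2) / (2 * s)) := by
  have hnn : 0 ≤ ∑ j ∈ Finset.range (k + 1),
      (empiricalDistribution x (j / k) - max 0 (min (j / k : ℝ) 1)) ^ 2 :=
    Finset.sum_nonneg fun _ _ ↦ sq_nonneg _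
  refine ciSup_le fun t ↦ abs_sub_clamp_le_of_grid (monotone_empiricalDistribution x)
    (fun t ht ↦ empiricalDistribution_of_nonpos x ht)
    (fun t ht ↦ empiricalDistribution_of_one_le hn x ht) hk (by positivity) (fun j hj ↦ ?_) t
  set d := empiricalDistribution x (j / k) - max 0 (min (j / k : ℝ) 1) with hd
  have h1 : d ^ 2 ≤ ∑ j ∈ Finset.range (k + 1),
      (empiricalDistribution x (j / k) - max 0 (min (j / k : ℝ) 1)) ^ 2 :=
    Finset.single_le_sum (f := fun j : ℕ ↦
      (empiricalDistribution x (j / k) - max 0 (min (j / k : ℝ) 1)) ^ 2)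
      (fun _ _ ↦ sq_nonneg _) (Finset.mem_range.2 (Nat.lt_succ_of_le hj))
  have h2 : |d| ≤ s / 2 + d ^ 2 / (2 * s) := by
    rw [div_add_div _ _ two_ne_zero (by positivity), le_div_iff₀ (by positivity)]
    nlinarith [sq_nonneg (s - |d|), sq_abs d]
  refine h2.trans ?_
  gcongr

end KolmogorovDeviation

theorem integral_kolmogorovDeviation_le {n : ℕ} (hn : 1 ≤ n) {C : Matrix (Fin n) (Fin n) ℝ}
    (hC : C.PosSemidef) (hdiag : ∀ i, C i i = 1) :
    ∫ x, kolmogorovDeviation x ∂(multivariateGaussian 0 C)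
      ≤ 16 * (((n : ℝ) + offDiagAbsSum C) / (n : ℝ) ^ 2) ^ (1 / 3 : ℝ) := by
  set μ := multivariateGaussian 0 C with hμ
  set V := ((n : ℝ) + offDiagAbsSum C) / (n : ℝ) ^ 2 with hVdef
  have hn0 : (0 : ℝ) < n := by exact_mod_cast hn
  have hoff : 0 ≤ offDiagAbsSum C :=
    Finset.sum_nonneg fun i _ ↦ Finset.sum_nonneg fun j _ ↦ by split_ifs <;> positivity
  have hV : 0 < V := by positivity
  set s := V ^ (1 / 3 : ℝ) with hsdef
  have hs : 0 < s := Real.rpow_pos_of_pos hV _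
  have hs3 : s ^ 3 = V := by
    rw [hsdef, ← Real.rpow_natCast, ← Real.rpow_mul hV.le]; norm_num
  rcases lt_or_ge 1 s with h1 | h1
  · have : ∫ x, kolmogorovDeviation x ∂μ ≤ ∫ _, (1 : ℝ) ∂μ :=
      integral_mono (integrable_kolmogorovDeviation μ) (integrable_const _)
        kolmogorovDeviation_le_one
    simp only [integral_const, probReal_univ, smul_eq_mul, mul_one] at this
    linarith
  set k := ⌈1 / s⌉₊ with hkdef
  have hk : 0 < k := Nat.ceil_pos.2 (by positivity)
  have hk1 : 1 / s ≤ k := Nat.le_ceil _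
  have hk2 : (k : ℝ) < 1 / s + 1 := Nat.ceil_lt_add_one (by positivity)
  have h1s : 1 ≤ 1 / s := (one_le_div hs).2 h1
  have hk3 : (k : ℝ) + 1 ≤ 3 * (1 / s) := by linarith
  have hk4 : 1 / (k : ℝ) ≤ s := by
    rw [div_le_iff₀ (by exact_mod_cast hk)]
    rw [div_le_iff₀ hs] at hk1
    linarith
  have hint (t : ℝ) :
      Integrable (fun x ↦ (empiricalDistribution x t - max 0 (min t 1)) ^ 2) μ := by
    refine Integrable.of_bound (((measurable_empiricalDistribution n t).sub_const _).pow_const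
      2).aestronglyMeasurable 1 (.of_forall fun x ↦ ?_)
    rw [Real.norm_eq_abs, abs_pow]
    exact pow_le_one₀ (abs_nonneg _) (abs_empiricalDistribution_sub_le_one x t)
  have hsum := integrable_finsetSum (Finset.range (k + 1)) fun j _ ↦ hint (j / k)
  calc ∫ x, kolmogorovDeviation x ∂μ
      ≤ ∫ x, (1 / (k : ℝ) + (s / 2 + (∑ j ∈ Finset.range (k + 1),
        (empiricalDistribution x (j / k) - max 0 (min (j / k : ℝ) 1)) ^ 2) / (2 * s))) ∂μ :=
        integral_mono (integrable_kolmogorovDeviation μ)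
          ((integrable_const _).add ((integrable_const _).add (hsum.div_const _)))
          fun x ↦ kolmogorovDeviation_le_grid x hn hk hs
    _ = 1 / (k : ℝ) + (s / 2 + (∑ j ∈ Finset.range (k + 1),
        ∫ x, (empiricalDistribution x (j / k) - max 0 (min (j / k : ℝ) 1)) ^ 2 ∂μ) / (2 * s)) := by
        have hsum' : Integrable (fun x ↦ s / 2 + (∑ j ∈ Finset.range (k + 1),
            (empiricalDistribution x (j / k) - max 0 (min (j / k : ℝ) 1)) ^ 2) / (2 * s)) μ :=
          (integrable_const _).add (hsum.div_const _)
        rw [integral_add (integrable_const _) hsum',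
          integral_add (integrable_const _) (hsum.div_const _), integral_const, integral_const,
          integral_div, integral_finsetSum _ fun (j : ℕ) _ ↦ hint (j / k)]
        simp
    _ ≤ 1 / (k : ℝ) + (s / 2 + (∑ j ∈ Finset.range (k + 1), 4 * V) / (2 * s)) := by
        gcongr with j _
        exact integral_sq_empiricalDistribution_sub_le hn hC hdiag _
    _ = 1 / (k : ℝ) + (s / 2 + (k + 1) * (2 * s ^ 2)) := by
        rw [← hs3]
        simp only [Finset.sum_const, Finset.card_range, nsmul_eq_mul]
        push_cast
        field_simp
        ring
    _ ≤ s + (s / 2 + 3 * (1 / s) * (2 * s ^ 2)) := by gcongr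
    _ = s + (s / 2 + 6 * s) := by field_simp; ring
    _ ≤ 16 * s := by linarith

theorem theorem2 {Ω : Type*} [MeasurableSpace Ω] (P : Measure Ω) [IsProbabilityMeasure P]
    (n : ℕ) (hn : 1 ≤ n)
    (C : Matrix (Fin n) (Fin n) ℝ) (hC : C.PosSemidef) (hdiag : ∀ i, C i i = 1)
    (X : Ω → EuclideanSpace ℝ (Fin n)) (hX : HasLaw X (multivariateGaussian 0 C) P) :
    (∀ t : ℝ, Integrable (fun ω => empiricalDistribution (X ω) t) P) ∧
    (∀ ω, BddAbove (Set.range fun t : ℝ =>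
      |empiricalDistribution (X ω) t - ∫ ω', empiricalDistribution (X ω') t ∂P|)) ∧
    Integrable (fun ω => ⨆ t : ℝ,
      |empiricalDistribution (X ω) t - ∫ ω', empiricalDistribution (X ω') t ∂P|) P ∧
    ∫ ω, (⨆ t : ℝ,
      |empiricalDistribution (X ω) t - ∫ ω', empiricalDistribution (X ω') t ∂P|) ∂P
      ≤ 16 * (((n : ℝ) + offDiagAbsSum C) / (n : ℝ) ^ 2) ^ (1 / 3 : ℝ) := by
  have hmean (t : ℝ) : ∫ ω', empiricalDistribution (X ω') t ∂P = max 0 (min t 1) := by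
    rw [← integral_empiricalDistribution hn hC hdiag t]
    exact hX.integral_comp (measurable_empiricalDistribution n t).aestronglyMeasurable
  simp only [hmean]
  refine ⟨fun t ↦ ?_, fun ω ↦ bddAbove_abs_empiricalDistribution_sub (X ω), ?_, ?_⟩
  · refine Integrable.of_bound ((measurable_empiricalDistribution n t).comp_aemeasurable
      hX.aemeasurable).aestronglyMeasurable 1 (.of_forall fun ω ↦ ?_)
    rw [Real.norm_eq_abs, abs_of_nonneg (empiricalDistribution_nonneg _ _)]
    exact empiricalDistribution_le_one _ _
  · have h := integrable_kolmogorovDeviation (P.map X)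
    exact h.comp_aemeasurable hX.aemeasurable
  · exact (hX.integral_comp measurable_kolmogorovDeviation.aestronglyMeasurable).trans_le
      (integral_kolmogorovDeviation_le hn hC hdiag)
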